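/- Let $G$ be a finite undirected simple graph with at least one vertex. Let $\mathrm{td}(G)$ denote its treedepth (the minimum height, counted as the number of vertices on a longest root-to-leaf path, of a rooted forest whose ancestor-descendant closure contains $G$ as a subgraph) and let $\mathrm{tw}(G)$ denote its treewidth. Then $G$ contains, as a (not necessarily induced) subgraph, a tree $H$ of maximum degree at most $3$ with $$\mathrm{td}(H) \;\ge\; \frac{\mathrm{td}(G)}{\mathrm{tw}(G)+1}\cdot\frac{\log\varphi}{\log 3},\qquad \varphi=\frac{1+\sqrt5}{2}.$$ Moreover, with the constant $C=\frac{\log 3}{\log\varphi}$, for all positive integers $a,b$: if $\mathrm{td}(G)\ge Cab$, then $\mathrm{tw}(G)\ge a$ or $G$ contains, as a subgraph, a tree of maximum degree at most $3$ and treedepth exactly $b$. -/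

import Mathlib

namespace SimpleGraph

/-- A rooted forest on the node set `F` (finite in all uses below), given by its ancestor order:
`u ≤ v` means that `u` is an ancestor of `v` or equal to it. The ancestors of every node form a
chain; the roots are the minimal nodes, and the parent of a node is the node it covers. -/
structure RootedForest (F : Type*) extends PartialOrder F where
  /-- The nodes above (and including) a given node lie on one path to a root. -/
  chain_ancestors : ∀ w u v : F, u ≤ w → v ≤ w → u ≤ v ∨ v ≤ u

namespace RootedForest

variable {F : Type*}

/-- The nodes on the path from `v` to its root, both ends included. -/
def ancestors (R : RootedForest F) (v : F) : Set F := {u | R.le u v}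

/-- The number of nodes on a longest path from a node to its root (for a finite node set). -/
noncomputable def height (R : RootedForest F) : ℕ := ⨆ v, (R.ancestors v).ncard

end RootedForest

variable {V : Type*}

/-- A treedepth decomposition of `G`: a finite rooted forest and an injective map of the vertices
of `G` to its nodes such that adjacent vertices are sent to nodes in ancestor-descendant relation.
(A finite node set can always be taken in `Type`.) -/
structure TreedepthDecomposition (G : SimpleGraph V) where
  /-- The nodes of the forest. -/
  Node : Type
  finite_node : Finite Node
  /-- The rooted forest. -/
  forest : RootedForest Node
  /-- The placement of the vertices. -/
  place : V → Node
  place_injective : Function.Injective place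
  related_of_adj : ∀ u v : V, G.Adj u v →
    place u ∈ forest.ancestors (place v) ∨ place v ∈ forest.ancestors (place u)

/-- The treedepth of a finite graph: the least height of a treedepth decomposition. -/
noncomputable def treedepth (G : SimpleGraph V) : ℕ :=
  sInf {k | ∃ D : TreedepthDecomposition G, D.forest.height = k}

/-- A tree decomposition of `G`, with a finite tree. -/
structure TreeDecomposition (G : SimpleGraph V) where
  /-- The nodes of the tree. -/
  Node : Type
  finite_node : Finite Node
  /-- The tree. -/
  tree : SimpleGraph Node
  isTree : tree.IsTree
  /-- The bags. -/
  bag : Node → Finset V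
  /-- The nodes whose bags contain `v` induce a nonempty connected subgraph of the tree. -/
  connected_bags : ∀ v : V, (tree.induce {t | v ∈ bag t}).Connected
  exists_bag_of_adj : ∀ u v : V, G.Adj u v → ∃ t, u ∈ bag t ∧ v ∈ bag t

/-- The width of a tree decomposition: the largest size of a bag, minus one.
(If `G` has a vertex, then some bag is nonempty and the subtraction does not truncate.) -/
noncomputable def TreeDecomposition.width {G : SimpleGraph V} (D : TreeDecomposition G) : ℕ :=
  (⨆ t, (D.bag t).card) - 1

/-- The treewidth of a finite nonempty graph: the least width of a tree decomposition. -/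
noncomputable def treewidth (G : SimpleGraph V) : ℕ :=
  sInf {k | ∃ D : TreeDecomposition G, D.width = k}

/-- The subgraph `H` is a tree of maximum degree at most three. -/
def Subgraph.IsSubcubicTree {G : SimpleGraph V} (H : G.Subgraph) : Prop :=
  H.coe.IsTree ∧ ∀ v ∈ H.verts, (H.neighborSet v).encard ≤ 3

end SimpleGraph

/-! Write c for the treewidth plus one. The engine is
`TreeDecomposition.exists_disjoint_connectedOn`: deleting any bag from a set of treedepth greater
than m + c leaves a component of treedepth greater than m, and an extremal choice of bags yields two
such components that are disjoint.

They extend to two adjacent connected parts of a connected set (`ConnectedOn.exists_partition`), and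
subcubic subgraphs of the parts are joined by an edge ab. The edge costs one incidence at a and at
b, so the induction must control degrees at prescribed vertices: `TreeDecomposition.hasSubcubic`
bounds together the size attainable through one given vertex and through two. The two bounds feed
each other by the Fibonacci recursion, so treedepth above cn gives a subcubic connected subgraph on
at least F(n+2) vertices.

A connected graph of maximum degree 3 and treedepth k has at most (3^k - 1)/2 vertices, so a
spanning tree of that subgraph has treedepth at least about n log φ / log 3. For the exact value b,
cut the tree down: deleting a vertex lowers treedepth by at most one, so all smaller positive values
occur on subtrees. -/

namespace SimpleGraph

variable {V : Type*}

/-! ### Connected vertex sets -/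

/-- The set `C` is nonempty and connected in `G`: no proper nonempty subset of `C` is closed under
adjacency in `C`. -/
def ConnectedOn (G : SimpleGraph V) (C : Set V) : Prop :=
  C.Nonempty ∧ ∀ A ⊆ C, A.Nonempty → (∀ a ∈ A, ∀ b ∈ C, G.Adj a b → b ∈ A) → C ⊆ A

theorem connectedOn_singleton (G : SimpleGraph V) (v : V) : G.ConnectedOn {v} := by
  refine ⟨⟨v, rfl⟩, ?_⟩
  rintro A hA ⟨a, ha⟩ -
  have : a = v := hA ha
  subst this
  simpa using ha

/-- A connected set that meets a set closed under adjacency in it is contained in that set. -/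
theorem ConnectedOn.subset_of_closed {G : SimpleGraph V} {C : Set V} (hC : G.ConnectedOn C)
    {A : Set V} (hne : (C ∩ A).Nonempty)
    (hcl : ∀ a ∈ C, a ∈ A → ∀ b ∈ C, G.Adj a b → b ∈ A) : C ⊆ A :=
  (hC.2 (C ∩ A) Set.inter_subset_left hne
    fun a ha b hb hab => ⟨hb, hcl a ha.1 ha.2 b hb hab⟩).trans Set.inter_subset_right

theorem connectedOn_iff (G : SimpleGraph V) (C : Set V) :
    G.ConnectedOn C ↔ (G.induce C).Connected := by
  constructor
  · intro h
    have : Nonempty C := h.1.to_subtype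
    refine ⟨fun x y => ?_⟩
    have := h.subset_of_closed (A := {z | ∃ hz : z ∈ C, (G.induce C).Reachable x ⟨z, hz⟩})
      ⟨x, x.2, x.2, Reachable.refl _⟩ ?_ y.2
    · exact this.2
    · rintro a ha ⟨_, hr⟩ b hb hab
      exact ⟨hb, hr.trans (Adj.reachable (by simpa using hab))⟩
  · intro h
    refine ⟨Set.nonempty_coe_sort.1 h.nonempty, ?_⟩
    rintro A hA ⟨a, ha⟩ hcl z hz
    have hr := h.preconnected ⟨a, hA ha⟩ ⟨z, hz⟩
    rw [reachable_iff_reflTransGen] at hr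
    have : ∀ w : C, Relation.ReflTransGen (G.induce C).Adj ⟨a, hA ha⟩ w → (w : V) ∈ A := by
      intro w hw
      induction hw with
      | refl => exact ha
      | tail _ hadj ih => exact hcl _ ih _ (Subtype.property _) (by simpa using hadj)
    exact this _ hr

/-- Two adjacent connected sets have a connected union. -/
theorem ConnectedOn.union_of_adj {G : SimpleGraph V} {A B : Set V} (hA : G.ConnectedOn A)
    (hB : G.ConnectedOn B) {a b : V} (ha : a ∈ A) (hb : b ∈ B) (hab : G.Adj a b) :
    G.ConnectedOn (A ∪ B) := by
  refine ⟨⟨a, Or.inl ha⟩, ?_⟩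
  rintro S hS ⟨s, hs⟩ hcl
  have key : ∀ C ⊆ A ∪ B, G.ConnectedOn C → (C ∩ S).Nonempty → C ⊆ S := fun C hC hconn hne =>
    hconn.subset_of_closed hne fun x _ hx y hy hxy => hcl x hx y (hC hy) hxy
  have kA := key A Set.subset_union_left hA
  have kB := key B Set.subset_union_right hB
  rcases hS hs with h | h
  · have h1 := kA ⟨s, h, hs⟩
    exact Set.union_subset h1 (kB ⟨b, hb, hcl a (h1 ha) b (Or.inr hb) hab⟩)
  · have h1 := kB ⟨s, h, hs⟩
    exact Set.union_subset (kA ⟨a, ha, hcl b (h1 hb) a (Or.inl ha) hab.symm⟩) h1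

theorem ConnectedOn.mono_graph {G G' : SimpleGraph V} (hle : G ≤ G') {C : Set V}
    (hC : G.ConnectedOn C) : G'.ConnectedOn C :=
  ⟨hC.1, fun A hA hne hcl => hC.2 A hA hne fun a ha b hb hab => hcl a ha b hb (hle hab)⟩

/-- Disjoint connected subsets of a connected set extend to a partition of it into two adjacent
connected sets. -/
theorem ConnectedOn.exists_partition [Finite V] {G : SimpleGraph V} {X A₀ B₀ : Set V}
    (hX : G.ConnectedOn X) (hA₀ : G.ConnectedOn A₀) (hB₀ : G.ConnectedOn B₀)
    (hA₀X : A₀ ⊆ X) (hB₀X : B₀ ⊆ X) (hdisj : Disjoint A₀ B₀) :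
    ∃ A B, A₀ ⊆ A ∧ B₀ ⊆ B ∧ G.ConnectedOn A ∧ G.ConnectedOn B ∧ Disjoint A B ∧ A ∪ B = X ∧
      ∃ a ∈ A, ∃ b ∈ B, G.Adj a b := by
  -- Take `A` maximal, so that its edges to the rest of `X` end only in `B₀`; the other part is `X \
  -- A`.
  obtain ⟨A, hA₀A, hA⟩ := (Set.toFinite
    {A : Set V | A ⊆ X \ B₀ ∧ G.ConnectedOn A}).exists_le_maximal
    (show A₀ ∈ _ from ⟨fun x hx => ⟨hA₀X hx, Set.disjoint_left.1 hdisj hx⟩, hA₀⟩)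
  obtain ⟨⟨hAX, hAc⟩, hmax⟩ := hA
  have hno : ∀ a ∈ A, ∀ x ∈ X, x ∉ A → x ∉ B₀ → ¬ G.Adj a x := by
    intro a ha x hx hxA hxB hadj
    have h1 := hAc.union_of_adj (connectedOn_singleton G x) ha rfl hadj
    refine hxA (hmax ⟨?_, h1⟩ Set.subset_union_left (Or.inr rfl))
    exact Set.union_subset hAX (by simpa using ⟨hx, hxB⟩)
  have hB₀B : B₀ ⊆ X \ A := fun x hx => ⟨hB₀X hx, fun h => (hAX h).2 hx⟩
  -- A union of components of `X \ A` that misses `B₀` would have no edge to `A` either, and so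
  -- would be cut off in `X`.
  have hdead : ∀ D ⊆ X \ A, D ∩ B₀ = ∅ → D.Nonempty →
      (∀ d ∈ D, ∀ b ∈ X \ A, G.Adj d b → b ∈ D) → False := by
    intro D hD hDB hne hcl
    obtain ⟨a, ha⟩ := hAc.1
    refine (hD (hX.2 D (fun x hx => (hD hx).1) hne ?_ (hAX ha).1)).2 ha
    intro d hd b hb hdb
    by_cases hbA : b ∈ A
    · exact absurd hdb.symm (hno b hbA d (hD hd).1 (hD hd).2
        fun h => (Set.eq_empty_iff_forall_notMem.1 hDB d ⟨hd, h⟩))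
    · exact hcl d hd b ⟨hb, hbA⟩ hdb
  refine ⟨A, X \ A, hA₀A, hB₀B, hAc, ⟨hB₀.1.mono hB₀B, ?_⟩, Set.disjoint_sdiff_right,
    Set.union_sdiff_cancel fun x hx => (hAX hx).1, ?_⟩
  · intro S hS hne hcl x hx
    by_contra hxS
    by_cases hSB : S ∩ B₀ = ∅
    · exact hdead S hS hSB hne hcl
    · have hsub : B₀ ⊆ S := hB₀.subset_of_closed
        (by rw [Set.inter_comm]; exact Set.nonempty_iff_ne_empty.2 hSB)
        fun a _ ha b hb hab => hcl a ha b (hB₀B hb) hab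
      refine hdead ((X \ A) \ S) Set.sdiff_subset ?_ ⟨x, hx, hxS⟩ ?_
      · ext y
        simp only [Set.mem_inter_iff, Set.mem_sdiff, Set.mem_empty_iff_false, iff_false]
        exact fun h => h.1.2 (hsub h.2)
      · intro d hd b hb hdb
        exact ⟨hb, fun h => hd.2 (hcl b h d hd.1 hdb.symm)⟩
  · by_contra hcon
    push Not at hcon
    obtain ⟨b, hb⟩ := hB₀.1
    refine (hB₀B hb).2 (hX.2 A (fun x hx => (hAX hx).1) hAc.1 ?_ (hB₀X hb))
    intro a ha y hy hay
    by_contra hyA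
    exact hcon a ha y ⟨hy, hyA⟩ hay

/-! ### Treedepth by vertex elimination -/

/-- `G.ElimDepth S k` says that the subgraph of `G` induced by `S` has treedepth at most `k`. -/
inductive ElimDepth (G : SimpleGraph V) : Set V → ℕ → Prop
  | empty (k : ℕ) : ElimDepth G ∅ k
  | insert (v : V) {S : Set V} {k : ℕ} (h : ElimDepth G S k) : ElimDepth G (insert v S) (k + 1)
  | union {S T : Set V} {k : ℕ} (hST : ∀ s ∈ S, ∀ t ∈ T, ¬ G.Adj s t) (hS : ElimDepth G S k)
      (hT : ElimDepth G T k) : ElimDepth G (S ∪ T) k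

namespace ElimDepth

variable {G : SimpleGraph V} {S T : Set V} {k l : ℕ}

theorem succ (h : G.ElimDepth S k) : G.ElimDepth S (k + 1) := by
  induction h with
  | empty k => exact .empty _
  | insert v _ ih => exact .insert v ih
  | union hST _ _ ihS ihT => exact .union hST ihS ihT

theorem mono_right (h : G.ElimDepth S k) (hkl : k ≤ l) : G.ElimDepth S l := by
  induction hkl with
  | refl => exact h
  | step _ ih => exact ih.succ

theorem mono_left (h : G.ElimDepth S k) (hTS : T ⊆ S) : G.ElimDepth T k := by
  induction h generalizing T with
  | empty k =>
    rw [Set.subset_empty_iff.1 hTS]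
    exact .empty _
  | @insert v S k _ ih =>
    by_cases hv : v ∈ T
    · rw [← Set.insert_sdiff_self_of_mem hv]
      exact .insert v (ih (by simpa [Set.sdiff_subset_iff] using hTS))
    · exact (ih ((Set.subset_insert_iff_of_notMem hv).1 hTS)).succ
  | @union S₁ S₂ k hST _ _ ih₁ ih₂ =>
    have : T = T ∩ S₁ ∪ T ∩ S₂ := by
      rw [← Set.inter_union_distrib_left, Set.inter_eq_left.2 hTS]
    rw [this]
    exact .union (fun s hs t ht => hST s hs.2 t ht.2) (ih₁ Set.inter_subset_right)
      (ih₂ Set.inter_subset_right)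

theorem eq_empty (h : G.ElimDepth S 0) : S = ∅ := by
  generalize hk : 0 = k at h
  induction h with
  | empty => rfl
  | insert => omega
  | union _ _ _ ihS ihT => rw [ihS hk, ihT hk, Set.union_empty]

theorem of_diff (Z : Finset V) (h : G.ElimDepth (S \ ↑Z) k) : G.ElimDepth S (k + Z.card) := by
  classical
  induction Z using Finset.induction_on generalizing S with
  | empty => simpa using h
  | insert a Z ha ih =>
    have h1 : G.ElimDepth (S \ {a}) (k + Z.card) := by
      apply ih
      convert h using 1
      ext x
      simp
      tauto
    rw [Finset.card_insert_of_notMem ha]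
    exact (h1.insert a).mono_left (by simp)

/-- Components can be eliminated in parallel: a disconnected set splits into two smaller sets with
no edges between them. -/
theorem of_connectedOn [Finite V] (h : ∀ C ⊆ S, G.ConnectedOn C → G.ElimDepth C k) :
    G.ElimDepth S k := by
  induction hn : S.ncard using Nat.strong_induction_on generalizing S with
  | _ n ih =>
    subst hn
    rcases S.eq_empty_or_nonempty with rfl | hne
    · exact .empty _
    by_cases hc : G.ConnectedOn S
    · exact h S subset_rfl hc
    · have : ∃ A ⊆ S, A.Nonempty ∧ (∀ a ∈ A, ∀ b ∈ S, G.Adj a b → b ∈ A) ∧ ¬ S ⊆ A := by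
        by_contra hcon
        push Not at hcon
        exact hc ⟨hne, hcon⟩
      obtain ⟨A, hAS, hAne, hcl, hSA⟩ := this
      have h1 : G.ElimDepth A k := ih _ (Set.ncard_lt_ncard ⟨hAS, hSA⟩)
        (fun C hC => h C (hC.trans hAS)) rfl
      have h2 : G.ElimDepth (S \ A) k := ih _ (Set.ncard_lt_ncard ⟨Set.sdiff_subset, fun hh => by
        obtain ⟨a, ha⟩ := hAne
        exact (hh (hAS ha)).2 ha⟩) (fun C hC => h C (hC.trans Set.sdiff_subset)) rfl
      rw [← Set.union_sdiff_cancel hAS]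
      exact .union (fun s hs t ht hst => ht.2 (hcl s hs t ht.1 hst)) h1 h2

theorem of_ncard [Finite V] (G : SimpleGraph V) (S : Set V) : G.ElimDepth S S.ncard := by
  have h : G.ElimDepth (S \ ↑(S.toFinite.toFinset)) 0 := by
    simpa using ElimDepth.empty 0
  have := h.of_diff
  rwa [zero_add, ← Set.ncard_eq_toFinset_card] at this

/-- An order witnessing that the subgraph induced by `S` has treedepth at most `k`. -/
theorem exists_order [Finite V] (h : G.ElimDepth S k) :
    ∃ R : V → V → Prop, (∀ x y, R x y → x ∈ S ∧ y ∈ S) ∧ (∀ x ∈ S, R x x) ∧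
      (∀ x y z, R x y → R y z → R x z) ∧ (∀ x y, R x y → R y x → x = y) ∧
      (∀ w u v, R u w → R v w → R u v ∨ R v u) ∧ (∀ v, {u | R u v}.ncard ≤ k) ∧
      ∀ u ∈ S, ∀ v ∈ S, G.Adj u v → R u v ∨ R v u := by
  induction h with
  | empty k => exact ⟨fun _ _ => False, by simp⟩
  | @insert v S k _ ih =>
    obtain ⟨R, hmem, hrefl, htrans, hanti, hchain, hcard, hadj⟩ := ih
    by_cases hv : v ∈ S
    · rw [Set.insert_eq_of_mem hv]
      exact ⟨R, hmem, hrefl, htrans, hanti, hchain, fun v => (hcard v).trans (Nat.le_succ k), hadj⟩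
    -- The new vertex becomes the common root, lengthening each chain by at most one.
    refine ⟨fun x y => R x y ∨ x = v ∧ y ∈ Insert.insert v S, ?_, ?_, ?_, ?_, ?_, ?_, ?_⟩
    · rintro x y (h | ⟨rfl, h⟩)
      · exact ⟨Or.inr (hmem _ _ h).1, Or.inr (hmem _ _ h).2⟩
      · exact ⟨Or.inl rfl, h⟩
    · rintro x (rfl | h)
      · exact Or.inr ⟨rfl, Or.inl rfl⟩
      · exact Or.inl (hrefl x h)
    · rintro x y z (h1 | ⟨rfl, h1⟩) (h2 | ⟨rfl, h2⟩)
      · exact Or.inl (htrans _ _ _ h1 h2)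
      · exact absurd (hmem _ _ h1).2 hv
      · exact Or.inr ⟨rfl, Or.inr (hmem _ _ h2).2⟩
      · exact Or.inr ⟨rfl, h2⟩
    · rintro x y (h1 | ⟨rfl, h1⟩) (h2 | ⟨rfl, h2⟩)
      · exact hanti _ _ h1 h2
      · exact absurd (hmem _ _ h1).2 hv
      · exact absurd (hmem _ _ h2).2 hv
      · rfl
    · rintro w x y (h1 | ⟨rfl, h1⟩) (h2 | ⟨rfl, h2⟩)
      · rcases hchain _ _ _ h1 h2 with h | h
        · exact Or.inl (Or.inl h)
        · exact Or.inr (Or.inl h)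
      · exact Or.inr (Or.inr ⟨rfl, Or.inr (hmem _ _ h1).1⟩)
      · exact Or.inl (Or.inr ⟨rfl, Or.inr (hmem _ _ h2).1⟩)
      · exact Or.inl (Or.inr ⟨rfl, Or.inl rfl⟩)
    · intro y
      calc _ ≤ (Insert.insert v {u | R u y}).ncard := Set.ncard_le_ncard (by
            rintro x (h | ⟨rfl, _⟩)
            · exact Or.inr h
            · exact Or.inl rfl)
        _ ≤ _ := (Set.ncard_insert_le _ _).trans (Nat.succ_le_succ (hcard y))
    · rintro x (rfl | hx) y hy hxy
      · exact Or.inl (Or.inr ⟨rfl, hy⟩)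
      · rcases hy with rfl | hy
        · exact Or.inr (Or.inr ⟨rfl, Or.inr hx⟩)
        · rcases hadj x hx y hy hxy with h | h
          · exact Or.inl (Or.inl h)
          · exact Or.inr (Or.inl h)
  | @union S T k hST _ _ ihS ihT =>
    obtain ⟨R, hmem, hrefl, htrans, hanti, hchain, hcard, hadj⟩ := ihS
    obtain ⟨Q, hmem', hrefl', htrans', hanti', hchain', hcard', hadj'⟩ := ihT
    -- `S` and `T` may overlap, so the second order is restricted to `T \ S`.
    refine ⟨fun x y => R x y ∨ Q x y ∧ x ∉ S ∧ y ∉ S, ?_, ?_, ?_, ?_, ?_, ?_, ?_⟩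
    · rintro x y (h | ⟨h, -⟩)
      · exact ⟨Or.inl (hmem _ _ h).1, Or.inl (hmem _ _ h).2⟩
      · exact ⟨Or.inr (hmem' _ _ h).1, Or.inr (hmem' _ _ h).2⟩
    · intro x hx
      by_cases hxS : x ∈ S
      · exact Or.inl (hrefl x hxS)
      · exact Or.inr ⟨hrefl' x (hx.resolve_left hxS), hxS, hxS⟩
    · grind
    · grind
    · grind
    · intro y
      by_cases hy : y ∈ S
      · exact (Set.ncard_le_ncard (by intro x hx; grind)).trans (hcard y)
      · exact (Set.ncard_le_ncard (by intro x hx; grind)).trans (hcard' y)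
    · intro x hx y hy hxy
      have := hxy.symm
      grind

end ElimDepth

/-! ### Elimination depth equals treedepth -/

theorem TreedepthDecomposition.elimDepth [Finite V] {G : SimpleGraph V}
    (D : G.TreedepthDecomposition) : G.ElimDepth Set.univ D.forest.height := by
  have := D.finite_node
  let _ := D.forest.toPartialOrder
  -- Generalized to a set `N` of nodes for induction on chain length: a connected set placed in `N`
  -- lies under one minimal node of `N`, whose removal shortens every chain beneath it.
  have key : ∀ (k : ℕ) (N : Set D.Node), (∀ x ∈ N, {u | u ∈ N ∧ u ≤ x}.ncard ≤ k) →
      G.ElimDepth (D.place ⁻¹' N) k := by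
    intro k
    induction k with
    | zero =>
      intro N hN
      have : N = ∅ := by
        by_contra hne
        obtain ⟨x, hx⟩ := Set.nonempty_iff_ne_empty.2 hne
        have := hN x hx
        rw [Nat.le_zero, Set.ncard_eq_zero] at this
        exact Set.eq_empty_iff_forall_notMem.1 this x ⟨hx, le_rfl⟩
      rw [this, Set.preimage_empty]
      exact .empty _
    | succ k ih =>
      intro N hN
      refine ElimDepth.of_connectedOn fun C hC hconn => ?_
      obtain ⟨c, hc⟩ := hconn.1
      obtain ⟨m, hmc, hm⟩ := (Set.toFinite N).exists_le_minimal (hC hc)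
      have hCm : C ⊆ {x | m ≤ D.place x} := by
        refine hconn.subset_of_closed ⟨c, hc, hmc⟩ ?_
        intro a ha hma b hb hab
        have hma : m ≤ D.place a := hma
        rcases D.related_of_adj a b hab with h | h
        · exact hma.trans h
        · rcases D.forest.chain_ancestors _ _ _ hma h with h' | h'
          · exact h'
          · exact hm.2 (hC hb) h'
      have hrest : G.ElimDepth (D.place ⁻¹' {x | x ∈ N ∧ m < x}) k := by
        refine ih _ fun x hx => ?_
        refine Nat.lt_succ_iff.1 ((Set.ncard_lt_ncard ?_).trans_le (hN x hx.1))
        refine ⟨fun u hu => ⟨hu.1.1, hu.2⟩, fun hsub => ?_⟩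
        exact lt_irrefl _ (hsub (show m ∈ _ from ⟨hm.1, hx.2.le⟩)).1.2
      -- The node `m` need not carry a vertex; then the level is simply wasted.
      by_cases hv : ∃ v, D.place v = m
      · obtain ⟨v, hv⟩ := hv
        refine (hrest.insert v).mono_left fun x hx => ?_
        rcases (hCm hx : m ≤ D.place x).eq_or_lt with h | h
        · exact Or.inl (D.place_injective (h.symm.trans hv.symm))
        · exact Or.inr ⟨hC hx, h⟩
      · push Not at hv
        exact hrest.succ.mono_left fun x hx =>
          ⟨hC hx, lt_of_le_of_ne (hCm hx) (hv x).symm⟩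
  refine key _ Set.univ fun x _ => ?_
  have : {u | u ∈ Set.univ ∧ u ≤ x} = D.forest.ancestors x := by
    ext u
    simp [RootedForest.ancestors]
  rw [this]
  exact le_ciSup (f := fun v => (D.forest.ancestors v).ncard) (Set.finite_range _).bddAbove x

theorem ElimDepth.exists_treedepthDecomposition [Finite V] {G : SimpleGraph V} {k : ℕ}
    (h : G.ElimDepth Set.univ k) : ∃ D : G.TreedepthDecomposition, D.forest.height ≤ k := by
  obtain ⟨R, -, hrefl, htrans, hanti, hchain, hcard, hadj⟩ := h.exists_order
  let e := Finite.equivFin V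
  -- Nodes must live in `Type`, whatever the universe of `V`.
  refine ⟨⟨Fin (Nat.card V), inferInstance,
    { le := fun a b => R (e.symm a) (e.symm b)
      lt := fun a b => R (e.symm a) (e.symm b) ∧ ¬ R (e.symm b) (e.symm a)
      lt_iff_le_not_ge := fun _ _ => Iff.rfl
      le_refl := fun a => hrefl _ trivial
      le_trans := fun a b c => htrans _ _ _
      le_antisymm := fun a b h1 h2 => e.symm.injective (hanti _ _ h1 h2)
      chain_ancestors := fun w u v => hchain _ _ _ }, e, e.injective, ?_⟩, ?_⟩
  · intro u v huv
    change R (e.symm (e u)) (e.symm (e v)) ∨ R (e.symm (e v)) (e.symm (e u))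
    simpa using hadj u trivial v trivial huv
  · refine ciSup_le' fun v => ?_
    refine le_trans ?_ (hcard (e.symm v))
    refine Set.ncard_le_ncard_of_injOn e.symm (fun u hu => hu) e.symm.injective.injOn

theorem treedepth_le_iff [Finite V] (G : SimpleGraph V) (k : ℕ) :
    G.treedepth ≤ k ↔ G.ElimDepth Set.univ k := by
  constructor
  · intro h
    obtain ⟨D₀, -⟩ := (ElimDepth.of_ncard G Set.univ).exists_treedepthDecomposition
    obtain ⟨D, hD⟩ := Nat.sInf_mem (show {k | ∃ D : G.TreedepthDecomposition,
      D.forest.height = k}.Nonempty from ⟨_, D₀, rfl⟩)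
    exact D.elimDepth.mono_right (hD.trans_le h)
  · intro h
    obtain ⟨D, hD⟩ := h.exists_treedepthDecomposition
    refine le_trans (Nat.sInf_le ?_) hD
    exact ⟨D, rfl⟩

/-! ### Tree decompositions and disjoint connected sets -/

/-- In a tree, every connected set lies behind one of its nodes, as seen from the root `r`. -/
theorem IsTree.exists_top {N : Type*} {T : SimpleGraph N} (hT : T.IsTree) (r : N) :
    ∃ (depth : N → ℕ) (below : N → Set N),
      (∀ W : Set N, T.ConnectedOn W → ∀ s ∈ W, (∀ x ∈ W, depth s ≤ depth x) → W ⊆ below s) ∧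
      (∀ W : Set N, T.ConnectedOn W → ∀ s ∉ W, (W ∩ below s).Nonempty → W ⊆ below s) ∧
      ∀ s, ∀ x ∈ below s, x ≠ s → depth s < depth x := by
  choose P hP hPu using fun v => hT.existsUnique_path r v
  -- Of two adjacent nodes, one is the parent of the other.
  have hcase : ∀ x y (h : T.Adj x y), P y = (P x).concat h ∨ P x = (P y).concat h.symm := by
    intro x y h
    by_cases hx : x ∈ (P y).support
    · exact Or.inl (hT.isAcyclic.path_concat (hP x) (hP y) h hx)
    · exact Or.inr (hT.isAcyclic.path_concat (hP y) (hP x) h.symm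
        (hT.isAcyclic.mem_support_of_ne_mem_support_of_adj_of_isPath (hP x) (hP y) h hx))
  refine ⟨fun v => (P v).length, fun s => {x | s ∈ (P x).support}, ?_, ?_, ?_⟩
  · intro W hW s hs hmin
    refine hW.subset_of_closed ⟨s, hs, (P s).end_mem_support⟩ ?_
    intro a ha has b hb hab
    rcases hcase a b hab with h | h
    · simp only [Set.mem_ofPred_eq, h, Walk.support_concat] at has ⊢
      simp [has]
    · simp only [Set.mem_ofPred_eq, h, Walk.support_concat, List.mem_append,
        List.mem_singleton] at has
      rcases has with has | rfl
      · exact has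
      · have : (P s).length ≤ (P b).length := hmin b hb
        rw [h, Walk.length_concat] at this
        omega
  · rintro W hW s hs hne
    refine hW.subset_of_closed hne ?_
    intro a ha has b hb hab
    rcases hcase a b hab with h | h
    · simp only [Set.mem_ofPred_eq, h, Walk.support_concat] at has ⊢
      simp [has]
    · simp only [Set.mem_ofPred_eq, h, Walk.support_concat, List.mem_append,
        List.mem_singleton] at has
      rcases has with has | rfl
      · exact has
      · exact absurd ha hs
  · intro s x hx hne
    have hx : s ∈ (P x).support := hx
    classical
    change (P s).length < (P x).length
    rw [← hPu s _ ((hP x).takeUntil hx)]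
    refine (Walk.length_takeUntil_lt_length hx hne.symm)

/-- The nodes whose bags meet a connected set induce a connected subgraph of the tree. -/
theorem TreeDecomposition.connectedOn_nodes {G : SimpleGraph V} (D : G.TreeDecomposition)
    {C : Set V} (hC : G.ConnectedOn C) : D.tree.ConnectedOn {t | ∃ v ∈ C, v ∈ D.bag t} := by
  have hbag : ∀ v, D.tree.ConnectedOn {t | v ∈ D.bag t} := fun v =>
    (connectedOn_iff _ _).2 (D.connected_bags v)
  obtain ⟨v, hv⟩ := hC.1
  obtain ⟨t, ht⟩ := (hbag v).1
  refine ⟨⟨t, v, hv, ht⟩, ?_⟩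
  rintro A hA ⟨s, hs⟩ hcl
  have hmeet : ∀ v ∈ C, ∀ t ∈ A, v ∈ D.bag t → {t | v ∈ D.bag t} ⊆ A := fun v hv t ht hvt =>
    (hbag v).subset_of_closed ⟨t, hvt, ht⟩ fun a _ ha b hb hab => hcl a ha b ⟨v, hv, hb⟩ hab
  obtain ⟨w, hw, hws⟩ := hA hs
  have := hC.subset_of_closed (A := {v | {t | v ∈ D.bag t} ⊆ A})
    ⟨w, hw, hmeet w hw s hs hws⟩ fun a _ haA b hb hab => by
      obtain ⟨t, hat, hbt⟩ := D.exists_bag_of_adj a b hab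
      exact hmeet b hb t (haA hat) hbt
  rintro t ⟨v, hv, hvt⟩
  exact this hv hvt

/-- If the bags of a tree decomposition have at most `c` vertices, then a set of treedepth
greater than `m + c` contains two disjoint connected sets of treedepth greater than `m`. -/
theorem TreeDecomposition.exists_disjoint_connectedOn [Finite V] {G : SimpleGraph V}
    (D : G.TreeDecomposition) {c m : ℕ} (hc : ∀ t, (D.bag t).card ≤ c) {X : Set V}
    (hX : ¬ G.ElimDepth X (m + c)) :
    ∃ A ⊆ X, ∃ B ⊆ X, Disjoint A B ∧ G.ConnectedOn A ∧ G.ConnectedOn B ∧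
      ¬ G.ElimDepth A m ∧ ¬ G.ElimDepth B m := by
  have := D.finite_node
  -- Otherwise all components of `X` minus the bag have treedepth at most `m`, and putting the bag
  -- back costs at most `c`.
  have hex : ∀ t, ∃ C ⊆ X \ ↑(D.bag t), G.ConnectedOn C ∧ ¬ G.ElimDepth C m := by
    intro t
    by_contra hcon
    push Not at hcon
    exact hX ((ElimDepth.of_connectedOn hcon).of_diff.mono_right (Nat.add_le_add_left (hc t) m))
  choose C hCX hCc hCm using hex
  let W : D.Node → Set D.Node := fun t => {s | ∃ v ∈ C t, v ∈ D.bag s}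
  have hW : ∀ t, D.tree.ConnectedOn (W t) := fun t => D.connectedOn_nodes (hCc t)
  have hself : ∀ t, t ∉ W t := fun t ⟨v, hv, hvt⟩ => (hCX t hv).2 hvt
  have hne : Nonempty D.Node := D.isTree.connected.nonempty
  obtain ⟨depth, below, htop, hbelow, hlt⟩ := D.isTree.exists_top hne.some
  choose top htopW htopmin using fun t => (W t).exists_min_image depth (Set.toFinite _) (hW t).1
  -- Choose `t` so that the top node of `W t` is deepest. If `C t` met `C (top t)`, then `W (top
  -- t)`, which avoids `top t`, would lie strictly below it and have a deeper top.
  obtain ⟨t, ht⟩ := Finite.exists_max fun t => depth (top t)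
  have h1 : W t ⊆ below (top t) := htop _ (hW t) _ (htopW t) (htopmin t)
  refine ⟨C t, fun x hx => (hCX t hx).1, C (top t), fun x hx => (hCX _ hx).1, ?_, hCc _, hCc _,
    hCm _, hCm _⟩
  rw [Set.disjoint_left]
  intro v hv hv'
  obtain ⟨⟨s, hs⟩⟩ := (D.connected_bags v).nonempty
  have h2 := hbelow _ (hW (top t)) _ (hself _) ⟨s, ⟨v, hv', hs⟩, h1 ⟨v, hv, hs⟩⟩
  have h3 := hlt _ _ (h2 (htopW (top t))) fun h =>
    hself (top t) (by have := htopW (top t); rwa [h] at this)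
  exact (ht (top t)).not_gt h3

/-- The one-bag decomposition makes the set of widths nonempty, so the infimum is attained. -/
theorem exists_treeDecomposition_card_bag_le [Finite V] (G : SimpleGraph V) :
    ∃ D : G.TreeDecomposition, ∀ t, (D.bag t).card ≤ G.treewidth + 1 := by
  have := Fintype.ofFinite V
  have hne : {k | ∃ D : G.TreeDecomposition, D.width = k}.Nonempty := by
    refine ⟨_, ⟨Unit, inferInstance, ⊥, IsTree.of_subsingleton, fun _ => Finset.univ,
      fun v => ?_, fun u v _ => ⟨(), by simp⟩⟩, rfl⟩
    rw [← connectedOn_iff]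
    convert connectedOn_singleton _ ()
    ext
    simp
  obtain ⟨D, hD⟩ := Nat.sInf_mem hne
  refine ⟨D, fun t => ?_⟩
  have := D.finite_node
  have h1 : (D.bag t).card ≤ ⨆ t, (D.bag t).card :=
    le_ciSup (f := fun t => (D.bag t).card) (Set.finite_range _).bddAbove t
  have h2 : (⨆ t, (D.bag t).card) - 1 = G.treewidth := hD
  omega

/-! ### Subcubic connected subgraphs with reserved incidences -/

open Classical in
/-- `X` contains a connected subgraph of `G` of maximum degree at most three with at least `m`
vertices, among them all elements of `L`, in which every `v` has at least as many spare incidences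
as it has occurrences in `L`. -/
def HasSubcubic (G : SimpleGraph V) (X : Set V) (m : ℕ) (L : Multiset V) : Prop :=
  ∃ (K : SimpleGraph V) (C : Set V), K ≤ G ∧ K.ConnectedOn C ∧ C ⊆ X ∧
    (∀ a b, K.Adj a b → a ∈ C) ∧ (∀ a ∈ L, a ∈ C) ∧
    (∀ v, (K.neighborSet v).ncard + L.count v ≤ 3) ∧ m ≤ C.ncard

namespace HasSubcubic

variable {G : SimpleGraph V} {X Y : Set V} {m n : ℕ} {L L' : Multiset V}

theorem mono (h : G.HasSubcubic X m L) (hXY : X ⊆ Y) (hn : n ≤ m) (hL : L' ≤ L) :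
    G.HasSubcubic Y n L' := by
  classical
  obtain ⟨K, C, hKG, hC, hCX, hadj, hLC, hdeg, hm⟩ := h
  exact ⟨K, C, hKG, hC, hCX.trans hXY, hadj, fun a ha => hLC a (Multiset.mem_of_le hL ha),
    fun v => (Nat.add_le_add_left (Multiset.count_le_of_le v hL) _).trans (hdeg v), hn.trans hm⟩

/-- An isolated vertex has all three incidences to spare. -/
theorem singleton (G : SimpleGraph V) (v : V) : G.HasSubcubic {v} 1 {v, v, v} := by
  classical
  refine ⟨⊥, {v}, bot_le, connectedOn_singleton _ _, subset_rfl, by simp, by simp, ?_, by simp⟩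
  intro w
  have : (⊥ : SimpleGraph V).neighborSet w = ∅ := by ext; simp
  rw [this, Set.ncard_empty, zero_add]
  exact (Multiset.count_le_card _ _).trans (by simp)

/-- Joining two subcubic subgraphs by an edge. -/
theorem join [Finite V] {A B : Set V} {a b : V} {L₁ L₂ : Multiset V}
    (h₁ : G.HasSubcubic A m (a ::ₘ L₁)) (h₂ : G.HasSubcubic B n (b ::ₘ L₂))
    (hAB : Disjoint A B) (hab : G.Adj a b) : G.HasSubcubic (A ∪ B) (m + n) (L₁ + L₂) := by
  classical
  obtain ⟨K₁, C₁, hK₁, hC₁, hCX₁, hadj₁, hL₁, hdeg₁, hm₁⟩ := h₁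
  obtain ⟨K₂, C₂, hK₂, hC₂, hCX₂, hadj₂, hL₂, hdeg₂, hm₂⟩ := h₂
  have hdisj : Disjoint C₁ C₂ := hAB.mono hCX₁ hCX₂
  have hne : a ≠ b := hab.ne
  have ha : a ∈ C₁ := hL₁ a (by simp)
  have hb : b ∈ C₂ := hL₂ b (by simp)
  have hK : ∀ x y, (K₁ ⊔ K₂ ⊔ edge a b).Adj x y ↔
      K₁.Adj x y ∨ K₂.Adj x y ∨ x = a ∧ y = b ∨ x = b ∧ y = a := by
    intro x y
    rw [sup_adj, sup_adj, edge_adj]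
    constructor
    · tauto
    · rintro (h | h | ⟨rfl, rfl⟩ | ⟨rfl, rfl⟩) <;> simp_all [hne.symm]
  refine ⟨K₁ ⊔ K₂ ⊔ edge a b, C₁ ∪ C₂, ?_, ?_, Set.union_subset_union hCX₁ hCX₂, ?_, ?_, ?_, ?_⟩
  · intro x y hxy
    rcases (hK x y).1 hxy with h | h | ⟨rfl, rfl⟩ | ⟨rfl, rfl⟩
    exacts [hK₁ h, hK₂ h, hab, hab.symm]
  · exact (hC₁.mono_graph (le_sup_left.trans le_sup_left)).union_of_adj
      (hC₂.mono_graph (le_sup_right.trans le_sup_left)) ha hb ((hK a b).2 (by simp))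
  · intro x y hxy
    rcases (hK x y).1 hxy with h | h | ⟨rfl, rfl⟩ | ⟨rfl, rfl⟩
    exacts [Or.inl (hadj₁ _ _ h), Or.inr (hadj₂ _ _ h), Or.inl ha, Or.inr hb]
  · intro x hx
    rcases Multiset.mem_add.1 hx with h | h
    · exact Or.inl (hL₁ x (Multiset.mem_cons_of_mem h))
    · exact Or.inr (hL₂ x (Multiset.mem_cons_of_mem h))
  -- The degree count on one side, stated so that it applies to both: the new edge consumes the
  -- occurrence of `a` dropped from `a ::ₘ L`.
  · have hlocal : ∀ (K K' : SimpleGraph V) (C C' : Set V) (a b : V) (L L' : Multiset V),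
        Disjoint C C' → b ∈ C' → (∀ a b, K'.Adj a b → a ∈ C') → (∀ x ∈ b ::ₘ L', x ∈ C') →
        (∀ v, (K.neighborSet v).ncard + (a ::ₘ L).count v ≤ 3) → ∀ v ∈ C,
        {y | K.Adj v y ∨ K'.Adj v y ∨ v = a ∧ y = b ∨ v = b ∧ y = a}.ncard
          + (L + L').count v ≤ 3 := by
      intro K K' C C' a b L L' hCC hbC' hK' hL' hdeg v hv
      have hvC' : v ∉ C' := Set.disjoint_left.1 hCC hv
      have hvb : v ≠ b := fun h => hvC' (h ▸ hbC')
      have hcount : L'.count v = 0 := Multiset.count_eq_zero.2 fun h =>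
        hvC' (hL' v (Multiset.mem_cons_of_mem h))
      have hd := hdeg v
      rw [Multiset.count_add, hcount, add_zero]
      by_cases hva : v = a
      · subst hva
        rw [Multiset.count_cons_self] at hd
        have : {y | K.Adj v y ∨ K'.Adj v y ∨ v = v ∧ y = b ∨ v = b ∧ y = v}.ncard ≤
            (K.neighborSet v).ncard + 1 := by
          refine (Set.ncard_le_ncard ?_).trans (Set.ncard_insert_le b _)
          rintro y (h | h | ⟨-, h⟩ | ⟨h, -⟩)
          exacts [Or.inr h, absurd (hK' _ _ h) hvC', Or.inl h, absurd h hvb]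
        omega
      · rw [Multiset.count_cons_of_ne hva] at hd
        refine le_trans (Nat.add_le_add_right (Set.ncard_le_ncard ?_) _) hd
        rintro y (h | h | ⟨h, -⟩ | ⟨h, -⟩)
        exacts [h, absurd (hK' _ _ h) hvC', absurd h hva, absurd h hvb]
    intro v
    have hset : (K₁ ⊔ K₂ ⊔ edge a b).neighborSet v =
        {y | K₁.Adj v y ∨ K₂.Adj v y ∨ v = a ∧ y = b ∨ v = b ∧ y = a} := by
      ext y
      exact hK v y
    rw [hset]
    by_cases h1 : v ∈ C₁
    · exact hlocal K₁ K₂ C₁ C₂ a b L₁ L₂ hdisj hb hadj₂ hL₂ hdeg₁ v h1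
    by_cases h2 : v ∈ C₂
    · have := hlocal K₂ K₁ C₂ C₁ b a L₂ L₁ hdisj.symm ha hadj₁ hL₁ hdeg₂ v h2
      rw [add_comm L₁ L₂]
      convert this using 4
      ext y
      tauto
    · have he : {y | K₁.Adj v y ∨ K₂.Adj v y ∨ v = a ∧ y = b ∨ v = b ∧ y = a} = ∅ := by
        ext y
        simp only [Set.mem_ofPred_eq, Set.mem_empty_iff_false, iff_false]
        rintro (h | h | ⟨rfl, -⟩ | ⟨rfl, -⟩)
        exacts [h1 (hadj₁ _ _ h), h2 (hadj₂ _ _ h), h1 ha, h2 hb]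
      have hc1 : L₁.count v = 0 := Multiset.count_eq_zero.2 fun h =>
        h1 (hL₁ v (Multiset.mem_cons_of_mem h))
      have hc2 : L₂.count v = 0 := Multiset.count_eq_zero.2 fun h =>
        h2 (hL₂ v (Multiset.mem_cons_of_mem h))
      rw [he, Multiset.count_add, hc1, hc2, Set.ncard_empty]
      omega
  · rw [Set.ncard_union_eq hdisj]
    omega

/-- Any three vertices of a connected set lie in a subcubic connected subgraph. -/
theorem triple [Finite V] (hX : G.ConnectedOn X) {x y z : V} (hx : x ∈ X) (hy : y ∈ X)
    (hz : z ∈ X) : G.HasSubcubic X 1 {x, y, z} := by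
  induction hn : X.ncard using Nat.strong_induction_on generalizing X x y z with
  | _ n ih =>
    subst hn
    by_cases hsub : X ⊆ {x}
    · have hyx : y = x := hsub hy
      have hzx : z = x := hsub hz
      subst hyx hzx
      exact (singleton G _).mono (by simpa using hx) le_rfl le_rfl
    obtain ⟨w, hw, hwx⟩ := Set.not_subset.1 hsub
    -- Both parts are smaller than the whole. Unless `A` holds all three vertices, each part holds
    -- at most two of them, and an end of the edge `ab` makes at most three again.
    obtain ⟨A, B, hA₀, hB₀, hA, hB, hAB, rfl, a, ha, b, hb, hab⟩ := hX.exists_partition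
      (connectedOn_singleton G x) (connectedOn_singleton G w) (by simpa using hx)
      (by simpa using hw) (by simpa using Ne.symm hwx)
    have hAlt : A.ncard < (A ∪ B).ncard := by
      have := hB.1.ncard_pos
      rw [Set.ncard_union_eq hAB]
      omega
    have hBlt : B.ncard < (A ∪ B).ncard := by
      have := hA.1.ncard_pos
      rw [Set.ncard_union_eq hAB]
      omega
    have hxA : x ∈ A := hA₀ rfl
    have tA := fun {x y z} (hx : x ∈ A) (hy : y ∈ A) (hz : z ∈ A) => ih _ hAlt hA hx hy hz rfl
    have tB := fun {x y z} (hx : x ∈ B) (hy : y ∈ B) (hz : z ∈ B) => ih _ hBlt hB hx hy hz rfl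
    rcases hy with hy | hy <;> rcases hz with hz | hz
    · exact (tA hxA hy hz).mono Set.subset_union_left le_rfl le_rfl
    · have h2 : G.HasSubcubic B 1 (b ::ₘ {z}) :=
        (tB hb hz hz).mono subset_rfl le_rfl (Multiset.cons_le_cons _ (Multiset.le_cons_self _ _))
      exact (join (tA ha hxA hy) h2 hAB hab).mono subset_rfl (by omega) (by rfl)
    · have h2 : G.HasSubcubic B 1 (b ::ₘ {y}) :=
        (tB hb hy hy).mono subset_rfl le_rfl (Multiset.cons_le_cons _ (Multiset.le_cons_self _ _))
      refine (join (tA ha hxA hz) h2 hAB hab).mono subset_rfl (by omega) (le_of_eq ?_)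
      change x ::ₘ y ::ₘ z ::ₘ 0 = x ::ₘ z ::ₘ y ::ₘ 0
      rw [Multiset.cons_swap y z]
    · have h1 : G.HasSubcubic A 1 (a ::ₘ {x}) :=
        (tA ha hxA hxA).mono subset_rfl le_rfl (Multiset.cons_le_cons _ (Multiset.le_cons_self _ _))
      exact (join h1 (tB hb hy hz) hAB hab).mono subset_rfl (by omega) (by rfl)

end HasSubcubic

/-- A connected set of treedepth greater than `c * n` contains a subcubic connected subgraph with
at least `fib (n + 2)` vertices through any given vertex, and one with at least `fib (n + 1)`
vertices through any two. -/
theorem TreeDecomposition.hasSubcubic [Finite V] {G : SimpleGraph V} (D : G.TreeDecomposition)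
    {c : ℕ} (hc : ∀ t, (D.bag t).card ≤ c) (n : ℕ) {X : Set V} (hX : G.ConnectedOn X)
    (hXn : ¬ G.ElimDepth X (c * n)) :
    (∀ u ∈ X, G.HasSubcubic X (Nat.fib (n + 2)) {u}) ∧
      ∀ u ∈ X, ∀ v ∈ X, G.HasSubcubic X (Nat.fib (n + 1)) {u, v} := by
  induction n generalizing X with
  -- Both Fibonacci numbers are 1 here, so only connectedness is used.
  | zero =>
    refine ⟨fun u hu => ?_, fun u hu v hv => ?_⟩
    · exact (HasSubcubic.triple hX hu hu hu).mono subset_rfl le_rfl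
        (Multiset.cons_le_cons _ (Multiset.zero_le _))
    · exact (HasSubcubic.triple hX hv hu hv).mono subset_rfl le_rfl (Multiset.le_cons_self _ _)
  | succ n ih =>
    obtain ⟨A₀, hA₀X, B₀, hB₀X, hdisj, hA₀, hB₀, hA₀n, hB₀n⟩ :=
      D.exists_disjoint_connectedOn (m := c * n) hc hXn
    obtain ⟨A, B, hA₀A, hB₀B, hA, hB, hAB, rfl, a, ha, b, hb, hab⟩ :=
      hX.exists_partition hA₀ hB₀ hA₀X hB₀X hdisj
    have ihA := ih hA fun h => hA₀n (h.mono_left hA₀A)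
    have ihB := ih hB fun h => hB₀n (h.mono_left hB₀B)
    have hfib3 : Nat.fib (n + 1 + 2) = Nat.fib (n + 1) + Nat.fib (n + 2) := Nat.fib_add_two
    have hfib2 : Nat.fib (n + 1 + 1) ≤ Nat.fib (n + 1) + Nat.fib (n + 1) := by
      rw [Nat.fib_add_two]
      exact Nat.add_le_add_right (Nat.fib_mono (Nat.le_succ n)) _
    refine ⟨?_, ?_⟩
    -- The part with `u` gives F(n+1) vertices through `u` and its end of `ab`; the other gives
    -- F(n+2) through its end.
    · rintro u (hu | hu)
      · exact ((ihA.2 a ha u hu).join (L₂ := 0) (ihB.1 b hb) hAB hab).mono subset_rfl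
          (by omega) (by simp)
      · exact ((ihA.1 a ha).join (L₁ := 0) (ihB.2 b hb u hu) hAB hab).mono subset_rfl
          (by omega) (by simp)
    -- If one part holds both vertices, it only links them to `ab` by `triple`, and the other part
    -- supplies F(n+2). If they are separated, each part supplies F(n+1).
    · rintro u (hu | hu) v (hv | hv)
      · exact ((HasSubcubic.triple hA ha hu hv).join (L₂ := 0) (ihB.1 b hb) hAB hab).mono
          subset_rfl (Nat.le_add_left _ _) (by simp)
      · exact ((ihA.2 a ha u hu).join (ihB.2 b hb v hv) hAB hab).mono subset_rfl
          (by omega) (by rfl)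
      · refine ((ihA.2 a ha v hv).join (ihB.2 b hb u hu) hAB hab).mono subset_rfl
          (by omega) (le_of_eq ?_)
        exact Multiset.cons_swap u v 0
      · exact ((ihA.1 a ha).join (L₁ := 0) (HasSubcubic.triple hB hb hu hv) hAB hab).mono
          subset_rfl (Nat.le_add_right _ _) (by simp)

/-! ### Treedepth under maps, and the size of subcubic graphs -/

theorem ElimDepth.preimage {W : Type*} {G : SimpleGraph V} {T : SimpleGraph W} (f : T →g G)
    (hf : Function.Injective f) {S : Set V} {k : ℕ} (h : G.ElimDepth S k) :
    T.ElimDepth (f ⁻¹' S) k := by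
  induction h with
  | empty k => exact .empty _
  | @insert v S k _ ih =>
    by_cases hv : ∃ w, f w = v
    · obtain ⟨w, rfl⟩ := hv
      refine (ih.insert w).mono_left fun x hx => ?_
      rcases hx with hx | hx
      · exact Or.inl (hf hx)
      · exact Or.inr hx
    · exact ih.succ.mono_left fun x hx => hx.resolve_left fun h => hv ⟨x, h⟩
  | union hST _ _ ihS ihT =>
    exact .union (fun s hs t ht hst => hST _ hs _ ht (f.map_adj hst)) ihS ihT

/-- An embedding is needed, since the absence of edges between the two sides of a union must carry
over. -/
theorem ElimDepth.image {W : Type*} {G : SimpleGraph V} {T : SimpleGraph W} (f : T ↪g G)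
    {S : Set W} {k : ℕ} (h : T.ElimDepth S k) : G.ElimDepth (f '' S) k := by
  induction h with
  | empty k =>
    rw [Set.image_empty]
    exact .empty _
  | insert v _ ih =>
    rw [Set.image_insert_eq]
    exact .insert _ ih
  | union hST _ _ ihS ihT =>
    rw [Set.image_union]
    refine .union ?_ ihS ihT
    rintro _ ⟨s, hs, rfl⟩ _ ⟨t, ht, rfl⟩ hst
    exact hST s hs t ht (f.map_adj_iff.1 hst)

theorem treedepth_induce_le_iff [Finite V] (G : SimpleGraph V) (C : Set V) (k : ℕ) :
    (G.induce C).treedepth ≤ k ↔ G.ElimDepth C k := by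
  rw [treedepth_le_iff]
  constructor
  · intro h
    exact (h.image (Embedding.induce C)).mono_left fun x hx => ⟨⟨x, hx⟩, trivial, rfl⟩
  · intro h
    exact (h.preimage (Embedding.induce C).toHom Subtype.val_injective).mono_left
      fun x _ => x.2

theorem treedepth_le_of_injective {W : Type*} [Finite V] [Finite W] {G : SimpleGraph V}
    {T : SimpleGraph W} (f : T →g G) (hf : Function.Injective f) : T.treedepth ≤ G.treedepth := by
  rw [treedepth_le_iff]
  exact ((treedepth_le_iff G _).1 le_rfl).preimage f hf

theorem Iso.treedepth_eq {W : Type*} [Finite V] [Finite W] {G : SimpleGraph V}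
    {T : SimpleGraph W} (e : T ≃g G) : T.treedepth = G.treedepth :=
  le_antisymm (treedepth_le_of_injective e.toHom e.injective)
    (treedepth_le_of_injective e.symm.toHom e.symm.injective)

/-- A connected set in a graph of maximum degree at most three that has treedepth at most `k`
has at most `(3 ^ k - 1) / 2` vertices. -/
theorem ElimDepth.two_mul_ncard_add_one_le [Finite V] {T : SimpleGraph V}
    (hdeg : ∀ v, (T.neighborSet v).ncard ≤ 3) {S : Set V} {k : ℕ} (h : T.ElimDepth S k)
    {C : Set V} (hCS : C ⊆ S) (hC : T.ConnectedOn C) : 2 * C.ncard + 1 ≤ 3 ^ k := by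
  classical
  have := Fintype.ofFinite V
  induction h generalizing C with
  | empty k =>
    obtain ⟨c, hc⟩ := hC.1
    exact (hCS hc).elim
  | @insert v S k _ ih =>
    by_cases hv : v ∈ C
    -- `D w` is the component of `w` in `C \ {v}`, with a dummy value for other `w`.
    · have hex : ∀ w, ∃ D : Set V, w ∈ C \ {v} → w ∈ D ∧ D ⊆ C \ {v} ∧ T.ConnectedOn D ∧
          ∀ x ∈ D, ∀ y ∈ C, y ≠ v → T.Adj x y → y ∈ D := by
        intro w
        by_cases hw : w ∈ C \ {v}
        · obtain ⟨D, hwD, hD⟩ := (Set.toFinite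
            {D : Set V | D ⊆ C \ {v} ∧ T.ConnectedOn D}).exists_le_maximal
            (show {w} ∈ _ from ⟨by simpa using hw, connectedOn_singleton T w⟩)
          refine ⟨D, fun _ => ⟨hwD rfl, hD.1.1, hD.1.2, fun x hx y hy hyv hxy => ?_⟩⟩
          refine hD.2 ⟨?_, hD.1.2.union_of_adj (connectedOn_singleton T y) hx rfl hxy⟩
            Set.subset_union_left (Or.inr rfl)
          exact Set.union_subset hD.1.1 (by simpa using ⟨hy, hyv⟩)
        · exact ⟨∅, fun h => absurd h hw⟩
      choose D hD using hex
      let N : Finset V := {w | T.Adj v w ∧ w ∈ C}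
      have hcover : C ⊆ ↑(Insert.insert v (N.biUnion fun w => (D w).toFinset)) := by
        refine hC.subset_of_closed ⟨v, hv, by simp⟩ ?_
        intro a haC ha b hb hab
        simp only [N, Finset.coe_insert, Finset.coe_biUnion, Set.mem_insert_iff, Set.mem_iUnion,
          Finset.mem_coe, Finset.mem_filter, Finset.mem_univ, true_and, Set.mem_toFinset] at ha ⊢
        by_cases hbv : b = v
        · exact Or.inl hbv
        right
        rcases ha with rfl | ⟨w, hw, haw⟩
        · exact ⟨b, ⟨hab, hb⟩, (hD b ⟨hb, hbv⟩).1⟩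
        · exact ⟨w, hw, (hD w ⟨hw.2, hw.1.ne'⟩).2.2.2 a haw b hb hbv hab⟩
      have hDcard : ∀ w ∈ N, ((D w).toFinset).card ≤ (3 ^ k - 1) / 2 := by
        intro w hw
        have hw : T.Adj v w ∧ w ∈ C := by simpa [N] using hw
        obtain ⟨-, hDC, hDc, -⟩ := hD w ⟨hw.2, hw.1.ne'⟩
        have := ih (C := D w) (fun x hx => (hCS (hDC hx).1).resolve_left (hDC hx).2) hDc
        rw [Set.ncard_eq_toFinset_card'] at this
        omega
      have hN : N.card ≤ 3 := by
        refine le_trans ?_ (hdeg v)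
        rw [← Set.ncard_coe_finset]
        refine Set.ncard_le_ncard fun w hw => ?_
        have : T.Adj v w ∧ w ∈ C := by simpa [N] using hw
        exact this.1
      -- Every component of `C \ {v}` contains a neighbour of `v`, so there are at most three; 1 +
      -- 3(3^k - 1)/2 = (3^(k+1) - 1)/2.
      have h1 : C.ncard ≤ 1 + 3 * ((3 ^ k - 1) / 2) := by
        refine (Set.ncard_le_ncard hcover).trans ?_
        rw [Set.ncard_coe_finset]
        refine (Finset.card_insert_le _ _).trans ?_
        have := Finset.card_biUnion_le_card_mul N _ _ hDcard
        have := Nat.mul_le_mul_right ((3 ^ k - 1) / 2) hN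
        omega
      have h2 : 0 < 3 ^ k := by positivity
      rw [pow_succ]
      omega
    · have := ih ((Set.subset_insert_iff_of_notMem hv).1 hCS) hC
      rw [pow_succ]
      omega
  | @union S₁ S₂ k hST _ _ ih₁ ih₂ =>
    by_cases hne : (C ∩ S₁).Nonempty
    · refine ih₁ (hC.subset_of_closed hne ?_) hC
      intro a _ ha b hb hab
      by_contra hbS
      exact hST a ha b ((hCS hb).resolve_left hbS) hab
    · exact ih₂ (fun x hx => (hCS hx).resolve_left fun h => hne ⟨x, hx, h⟩) hC

/-- Every treedepth between one and that of `G` is attained by a connected induced subgraph. -/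
theorem exists_connectedOn_treedepth_eq [Finite V] (G : SimpleGraph V) {b : ℕ} (hb : 0 < b)
    (hbG : b ≤ G.treedepth) : ∃ C, G.ConnectedOn C ∧ (G.induce C).treedepth = b := by
  obtain ⟨k, rfl⟩ := Nat.exists_eq_add_of_lt hb
  simp only [zero_add] at *
  have hex : ({C : Set V | G.ConnectedOn C ∧ ¬ G.ElimDepth C k}).Nonempty := by
    by_contra hcon
    rw [Set.not_nonempty_iff_eq_empty, Set.eq_empty_iff_forall_notMem] at hcon
    have h1 : G.ElimDepth Set.univ k := ElimDepth.of_connectedOn fun C _ hC => by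
      by_contra hE
      exact hcon C ⟨hC, hE⟩
    have := (treedepth_le_iff G k).2 h1
    omega
  -- By minimality, removing any one vertex of `C` leaves treedepth at most `k`, so that of `C` is
  -- exactly `k + 1`.
  obtain ⟨C, hC⟩ := (Set.toFinite _).exists_minimal hex
  obtain ⟨⟨hCc, hCk⟩, hmin⟩ := hC
  refine ⟨C, hCc, le_antisymm ?_ ?_⟩
  · rw [treedepth_induce_le_iff]
    obtain ⟨v, hv⟩ := hCc.1
    rw [← Set.insert_sdiff_self_of_mem hv]
    refine ElimDepth.insert v (ElimDepth.of_connectedOn fun D hD hDc => ?_)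
    by_contra hE
    exact (hD (hmin ⟨hDc, hE⟩ (hD.trans Set.sdiff_subset) hv)).2 rfl
  · by_contra hlt
    exact hCk ((treedepth_induce_le_iff G C k).1 (by omega))

/-- The image of a subcubic tree under an injective homomorphism is a subcubic tree. -/
theorem exists_isSubcubicTree_of_injective {W : Type*} [Finite V] [Finite W] {G : SimpleGraph V}
    {T : SimpleGraph W} (hT : T.IsTree) (hdeg : ∀ v, (T.neighborSet v).ncard ≤ 3) (f : T →g G)
    (hf : Function.Injective f) :
    ∃ H : G.Subgraph, H.IsSubcubicTree ∧ H.coe.treedepth = T.treedepth := by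
  let H : G.Subgraph :=
    { verts := Set.range f
      Adj := Relation.Map T.Adj f f
      adj_sub := by
        rintro _ _ ⟨a, b, hab, rfl, rfl⟩
        exact f.map_adj hab
      edge_vert := by
        rintro _ _ ⟨a, b, hab, rfl, rfl⟩
        exact ⟨a, rfl⟩
      symm := ⟨by
        rintro _ _ ⟨a, b, hab, rfl, rfl⟩
        exact ⟨b, a, hab.symm, rfl, rfl⟩⟩ }
  have hadj : ∀ a b, Relation.Map T.Adj f f (f a) (f b) ↔ T.Adj a b := by
    intro a b
    constructor
    · rintro ⟨a', b', hab, ha, hb⟩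
      rwa [hf ha, hf hb] at hab
    · exact fun h => ⟨a, b, h, rfl, rfl⟩
  let e : T ≃g H.coe := ⟨Equiv.ofInjective f hf, fun {a b} => hadj a b⟩
  refine ⟨H, ⟨e.isTree_iff.1 hT, ?_⟩, e.treedepth_eq.symm⟩
  rintro _ ⟨w, rfl⟩
  have h1 : H.neighborSet (f w) ⊆ f '' T.neighborSet w := by
    rintro _ ⟨a, b, hab, ha, rfl⟩
    exact ⟨b, by rwa [hf ha] at hab, rfl⟩
  rw [← (Set.toFinite (H.neighborSet (f w))).cast_ncard_eq]
  exact_mod_cast (Set.ncard_le_ncard h1).trans ((Set.ncard_image_le).trans (hdeg w))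

/-! ### Subcubic trees and the final bounds -/

/-- A connected subcubic subgraph has a subcubic spanning tree, whose treedepth is at least
logarithmic in the number of vertices. -/
theorem HasSubcubic.exists_isTree [Finite V] {G : SimpleGraph V} {X : Set V} {m : ℕ}
    {L : Multiset V} (h : G.HasSubcubic X m L) :
    ∃ (C : Set V) (T : SimpleGraph C), T ≤ G.induce C ∧ T.IsTree ∧
      (∀ v, (T.neighborSet v).ncard ≤ 3) ∧ 2 * m + 1 ≤ 3 ^ T.treedepth := by
  obtain ⟨K, C, hKG, hC, -, -, -, hdeg, hm⟩ := h
  obtain ⟨T, hTK, hT⟩ := ((connectedOn_iff K C).1 hC).exists_isTree_le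
  have hdegT : ∀ v, (T.neighborSet v).ncard ≤ 3 := by
    intro v
    refine le_trans ?_ (le_trans (Nat.le_add_right _ _) (hdeg v))
    exact Set.ncard_le_ncard_of_injOn Subtype.val (fun w hw => hTK hw)
      Subtype.val_injective.injOn
  refine ⟨C, T, fun a b hab => hKG (hTK hab), hT, hdegT, ?_⟩
  have h1 : T.ConnectedOn Set.univ := by
    rw [connectedOn_iff]
    exact (induceUnivIso T).connected_iff.2 hT.connected
  have h2 := ((treedepth_le_iff T _).1 le_rfl).two_mul_ncard_add_one_le hdegT subset_rfl h1
  rw [Set.ncard_univ, Nat.card_coe_set_eq] at h2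
  omega

/-- The lower bound on the treedepth of a subcubic tree in `G`, for a tree on a vertex subset. -/
theorem exists_subcubic_tree_treedepth [Finite V] [Nonempty V] (G : SimpleGraph V) :
    ∃ (C : Set V) (T : SimpleGraph C), T ≤ G.induce C ∧ T.IsTree ∧
      (∀ v, (T.neighborSet v).ncard ≤ 3) ∧
      (G.treedepth : ℝ) / ((G.treewidth : ℝ) + 1) * (Real.log Real.goldenRatio / Real.log 3) ≤
        (T.treedepth : ℝ) := by
  obtain ⟨D, hD⟩ := G.exists_treeDecomposition_card_bag_le
  set c := G.treewidth + 1 with hc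
  set d := G.treedepth with hd
  have hd0 : 0 < d := by
    by_contra h0
    exact Set.univ_nonempty.ne_empty ((treedepth_le_iff G 0).1 (by omega)).eq_empty
  have hdiv := Nat.div_add_mod (d - 1) c
  have hmod := Nat.mod_lt (d - 1) (show 0 < c by omega)
  -- The largest `n` with `c * n < d`; hence `n + 1 ≥ d / c`.
  set n := (d - 1) / c
  have hE : ∃ X, G.ConnectedOn X ∧ ¬ G.ElimDepth X (c * n) := by
    by_contra hcon
    push Not at hcon
    have := (treedepth_le_iff G (c * n)).2 (ElimDepth.of_connectedOn fun C _ hC => hcon C hC)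
    omega
  obtain ⟨X, hX, hXn⟩ := hE
  obtain ⟨u, hu⟩ := hX.1
  obtain ⟨C, T, hTG, hT, hdeg, hcard⟩ := ((D.hasSubcubic hD n hX hXn).1 u hu).exists_isTree
  refine ⟨C, T, hTG, hT, hdeg, ?_⟩
  -- φ^(n+1) = φF(n+1) + F(n) ≤ 2F(n+2) + 1, because φ < 2.
  have hpow : Real.goldenRatio ^ (n + 1) ≤ 3 ^ T.treedepth := by
    rw [← Real.goldenRatio_mul_fib_succ_add_fib]
    have h1 : Real.goldenRatio * Nat.fib (n + 1) ≤ 2 * Nat.fib (n + 1) :=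
      mul_le_mul_of_nonneg_right Real.goldenRatio_lt_two.le (Nat.cast_nonneg _)
    have h2 : (2 * (Nat.fib n + Nat.fib (n + 1) : ℝ) + 1) ≤ 3 ^ T.treedepth := by
      rw [Nat.fib_add_two] at hcard
      exact_mod_cast hcard
    have h3 : (0 : ℝ) ≤ Nat.fib n := Nat.cast_nonneg _
    linarith
  have hlog3 : 0 < Real.log 3 := Real.log_pos (by norm_num)
  have hlogφ : 0 < Real.log Real.goldenRatio := Real.log_pos Real.one_lt_goldenRatio
  have hlog := Real.log_le_log (pow_pos Real.goldenRatio_pos _) hpow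
  rw [Real.log_pow, Real.log_pow] at hlog
  have hdc : (d : ℝ) / ((G.treewidth : ℝ) + 1) ≤ ((n + 1 : ℕ) : ℝ) := by
    rw [div_le_iff₀ (by positivity)]
    have : d ≤ (n + 1) * c := by
      rw [Nat.add_mul, mul_comm n c]
      omega
    exact_mod_cast this
  rw [← mul_div_assoc, div_le_iff₀ hlog3]
  exact (mul_le_mul_of_nonneg_right hdc hlogφ.le).trans hlog

end SimpleGraph

open SimpleGraph in
theorem theorem1 {V : Type*} [Finite V] [Nonempty V] (G : SimpleGraph V) :
    (∃ H : G.Subgraph, H.IsSubcubicTree ∧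
      (G.treedepth : ℝ) / ((G.treewidth : ℝ) + 1) *
          (Real.log ((1 + Real.sqrt 5) / 2) / Real.log 3) ≤ (H.coe.treedepth : ℝ)) ∧
    (∀ a b : ℕ, 0 < a → 0 < b →
      Real.log 3 / Real.log ((1 + Real.sqrt 5) / 2) * (a : ℝ) * (b : ℝ) ≤ (G.treedepth : ℝ) →
      a ≤ G.treewidth ∨ ∃ H : G.Subgraph, H.IsSubcubicTree ∧ H.coe.treedepth = b) := by
  obtain ⟨C, T, hTG, hT, hdeg, hle⟩ := G.exists_subcubic_tree_treedepth
  let f : T →g G := ⟨Subtype.val, fun {a b} hab => hTG hab⟩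
  have hf : Function.Injective f := Subtype.val_injective
  refine ⟨?_, fun a b ha hb hab => ?_⟩
  · obtain ⟨H, hH, hHT⟩ := exists_isSubcubicTree_of_injective hT hdeg f hf
    exact ⟨H, hH, by rw [hHT]; exact hle⟩
  · rw [or_iff_not_imp_left, not_le]
    intro hlt
    have hlog3 : 0 < Real.log 3 := Real.log_pos (by norm_num)
    have hlogφ : 0 < Real.log Real.goldenRatio := Real.log_pos Real.one_lt_goldenRatio
    have hbT : b ≤ T.treedepth := by
      have hw : (G.treewidth : ℝ) + 1 ≤ a := by exact_mod_cast hlt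
      have hw0 : (0 : ℝ) < (G.treewidth : ℝ) + 1 := by positivity
      have h1 : (b : ℝ) ≤ (G.treedepth : ℝ) / ((G.treewidth : ℝ) + 1) *
          (Real.log Real.goldenRatio / Real.log 3) := by
        have hab' : Real.log 3 / Real.log Real.goldenRatio * (a : ℝ) * (b : ℝ) ≤
          (G.treedepth : ℝ) := hab
        rw [div_mul_div_comm, le_div_iff₀ (by positivity)]
        calc (b : ℝ) * (((G.treewidth : ℝ) + 1) * Real.log 3)
            ≤ b * (a * Real.log 3) := by gcongr
          _ = Real.log 3 / Real.log Real.goldenRatio * (a : ℝ) * (b : ℝ) *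
              Real.log Real.goldenRatio := by field_simp
          _ ≤ _ := by gcongr
      exact_mod_cast h1.trans hle
    -- A connected set in a tree induces a tree, so `B` carries the required one.
    obtain ⟨B, hB, hBb⟩ := T.exists_connectedOn_treedepth_eq hb hbT
    obtain ⟨H, hH, hHT⟩ := exists_isSubcubicTree_of_injective (T := T.induce B)
      ⟨(connectedOn_iff T B).1 hB, hT.isAcyclic.induce B⟩
      (fun v => (Set.ncard_le_ncard_of_injOn Subtype.val (fun w hw => hw)
        Subtype.val_injective.injOn).trans (hdeg v))
      (f.comp (Embedding.induce B).toHom) (hf.comp Subtype.val_injective)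
    exact ⟨H, hH, hHT.trans hBb⟩
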